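/- Let $P = S_1 \times \dots \times S_N$ be a product of finitely many finite totally ordered sets, with the product partial order, let $\mathbb{F}$ be a field, and let $F \colon P \to \mathsf{Vec}_{\mathbb{F}}$ be a functor such that $F(x)$ is finite-dimensional for every $x \in P$. Suppose that $F$ is $k$-middle-exact for all $2 \le k \le N$. Then $F$ is interval decomposable. Here a $k$-cube in a category $\mathscr{C}$ is a functor $\mathcal{X}$ from the poset of subsets of $\{0,\dots,k-1\}$ to $\mathscr{C}$. It is strongly bicartesian if for all $A \subseteq B \subseteq \{0,\dots,k-1\}$ with $|B \setminus A| \ge 2$ the canonical maps $\operatorname{colim}_{A \subseteq S \subsetneq B} \mathcal{X}(S) \to \mathcal{X}(B)$ and $\mathcal{X}(A) \to \lim_{A \subsetneq S \subseteq B} \mathcal{X}(S)$ are isomorphisms. The Koszul complex of a $k$-cube $\mathcal{X}$ in $\mathsf{Vec}_{\mathbb{F}}$ is the chain complex $(K_{\mathcal{X}})_i = \bigoplus_{|S| = k-i} \mathcal{X}(S)$ whose differential $(K_{\mathcal{X}})_{i+1} \to (K_{\mathcal{X}})_i$ is given on the summand $\mathcal{X}(S)$ by $\sum_{j=0}^{i}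 (-1)^j \mathcal{X}(S \subseteq S \cup \{t_j\})$, where $t_0 < \dots < t_i$ are the elements of the complement of $S$. The functor $F$ is $k$-middle-exact if for every strongly bicartesian $k$-cube $\mathcal{X}$ in $P$ the Koszul complex of $F \circ \mathcal{X}$ has trivial homology in all degrees $0 < i < k$. An interval in $P$ is a nonempty subset $I \subseteq P$ such that $x \le z \le y$ with $x, y \in I$ implies $z \in I$, and such that any two elements of $I$ are connected by a finite zigzag $x = a_0 \le b_0 \ge a_1 \le \dots \le b_n = y$ of elements of $I$. The interval module $\mathbb{F}_I \colon P \to \mathsf{Vec}_{\mathbb{F}}$ is $\mathbb{F}$ at the points of $I$ and $0$ elsewhere, with identity maps between points of $I$ and zero maps otherwise. The functor $F$ is interval decomposable if it is isomorphic to a direct sum $\bigoplus_{j \in J} \mathbb{F}_{I_j}$ for some family $(I_j)_{j\in J}$ of intervals in $P$ (repetitions allowed). -/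

import Mathlib

open CategoryTheory Limits

open scoped DirectSum

universe u v w

noncomputable section

namespace Persistence

/-! ### Interval modules and interval decomposability -/

/-- An interval of a poset `P`: a nonempty subset which is convex and in which any two elements are
joined by a finite zigzag of comparable elements of the subset. -/
structure PosetInterval (P : Type v) [PartialOrder P] where
  /-- The underlying subset. -/
  carrier : Set P
  nonempty : carrier.Nonempty
  convex : ∀ ⦃x y z : P⦄, x ∈ carrier → y ∈ carrier → x ≤ z → z ≤ y → z ∈ carrier
  zigzag : ∀ ⦃x y : P⦄, x ∈ carrier → y ∈ carrier →
    Relation.ReflTransGen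
      (fun a b => a ∈ carrier ∧ b ∈ carrier ∧ (a ≤ b ∨ b ≤ a)) x y

open Classical in
/-- The value of the interval module at `x`: the line `K` (the subspace `⊤` of `K`) if `x ∈ I`, and
zero (the subspace `⊥` of `K`) otherwise. -/
def intervalFiber (K : Type u) [Field K] {P : Type v} [PartialOrder P] (I : PosetInterval P)
    (x : P) : Submodule K K :=
  if x ∈ I.carrier then ⊤ else ⊥

open Classical in
/-- The structure map of the interval module from `x` to `y`: the identity of `K` if `x, y ∈ I`, and
zero otherwise. -/
def intervalMap (K : Type u) [Field K] {P : Type v} [PartialOrder P] (I : PosetInterval P)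
    (x y : P) : intervalFiber K I x →ₗ[K] intervalFiber K I y :=
  if h : x ∈ I.carrier ∧ y ∈ I.carrier then
    Submodule.inclusion (by simp [intervalFiber, h.1, h.2])
  else 0

/-- The interval module `K_I` of an interval `I`. -/
def intervalModule (K : Type u) [Field K] {P : Type v} [PartialOrder P] (I : PosetInterval P) :
    P ⥤ ModuleCat.{u} K where
  obj x := ModuleCat.of K (intervalFiber K I x)
  map {x y} _ := ModuleCat.ofHom (intervalMap K I x y)
  map_id x := by
    by_cases hx : x ∈ I.carrier
    · ext a
      simp [intervalMap, hx]
    · have : Subsingleton (intervalFiber K I x) := by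
        simp only [intervalFiber, hx, if_false]
        infer_instance
      ext a
      exact congrArg Subtype.val (Subsingleton.elim (α := intervalFiber K I x) _ _)
  map_comp {x y z} f g := by
    rw [← ModuleCat.ofHom_comp]
    congr 1
    by_cases hx : x ∈ I.carrier <;> by_cases hz : z ∈ I.carrier
    · have hy : y ∈ I.carrier := I.convex hx hz (leOfHom f) (leOfHom g)
      ext a
      simp [intervalMap, hx, hy, hz]
    all_goals
      ext a
      simp [intervalMap, hx, hz]

/-- A persistence module is interval decomposable if it is isomorphic to a direct sum of a family
(repetitions allowed) of interval modules. -/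
def IsIntervalDecomposable {K : Type u} [Field K] {P : Type v} [PartialOrder P]
    (F : P ⥤ ModuleCat.{u} K) : Prop :=
  ∃ (ι : Type u) (I : ι → PosetInterval P),
    Nonempty (F ≅ ∐ fun i => intervalModule K (I i))

/-- Pointwise finite-dimensional persistence modules. -/
def IsPFD {K : Type u} [Field K] {P : Type v} [PartialOrder P]
    (F : P ⥤ ModuleCat.{u} K) : Prop :=
  ∀ x : P, FiniteDimensional K (F.obj x)

/-! ### Cubes -/

/-- A `k`-cube in `C`: a functor to `C` from the poset of subsets of a `k`-element set. -/
abbrev Cube (k : ℕ) (C : Type w) [Category.{v} C] := Finset (Fin k) ⥤ C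

/-- The face of the cube `X` spanned by `A ⊆ B` consists of the `X(S)` with `A ⊆ S ⊆ B`. This is the
canonical cocone with point `X(B)` on the punctured face `A ⊆ S ⊊ B`. -/
def faceCocone {k : ℕ} {C : Type w} [Category.{v} C] (X : Cube k C)
    (A B : Finset (Fin k)) : Cocone ((Subtype.mono_coe (· ∈ Set.Ico A B)).functor ⋙ X) where
  pt := X.obj B
  ι :=
    { app := fun S => X.map (homOfLE S.2.2.le)
      naturality := fun S T f => by
        refine Eq.trans ?_ (Category.comp_id _).symm
        exact (X.map_comp _ _).symm }

/-- The canonical cone with point `X(A)` on the punctured face `A ⊊ S ⊆ B`. -/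
def faceCone {k : ℕ} {C : Type w} [Category.{v} C] (X : Cube k C)
    (A B : Finset (Fin k)) : Cone ((Subtype.mono_coe (· ∈ Set.Ioc A B)).functor ⋙ X) where
  pt := X.obj A
  π :=
    { app := fun S => X.map (homOfLE S.2.1.le)
      naturality := fun S T f => by
        refine (Category.id_comp _).trans ?_
        exact X.map_comp _ _ }

/-- Every face of dimension at least two is cocartesian. -/
def IsStronglyCocartesian {k : ℕ} {C : Type w} [Category.{v} C] (X : Cube k C) :
    Prop :=
  ∀ A B : Finset (Fin k), A ⊆ B → 2 ≤ (B \ A).card → Nonempty (IsColimit (faceCocone X A B))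

/-- Every face of dimension at least two is cartesian. -/
def IsStronglyCartesian {k : ℕ} {C : Type w} [Category.{v} C] (X : Cube k C) :
    Prop :=
  ∀ A B : Finset (Fin k), A ⊆ B → 2 ≤ (B \ A).card → Nonempty (IsLimit (faceCone X A B))

/-- Strongly bicartesian cubes. -/
def IsStronglyBicartesian {k : ℕ} {C : Type w} [Category.{v} C] (X : Cube k C) :
    Prop :=
  IsStronglyCartesian X ∧ IsStronglyCocartesian X

/-! ### The Koszul complex -/

/-- The subsets of `Fin k` with `k - i` elements (there are none if `i > k`). -/
abbrev KoszulIndex (k i : ℕ) := {S : Finset (Fin k) // S.card + i = k}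

/-- `S ∪ {t}` as an index in degree `i`, for `S` an index in degree `i + 1` and `t ∉ S`. -/
def KoszulIndex.insert {k i : ℕ} (S : KoszulIndex k (i + 1)) (t : {t : Fin k // t ∉ S.1}) :
    KoszulIndex k i :=
  ⟨Insert.insert t.1 S.1, by
    have h := S.2
    rw [Finset.card_insert_of_notMem t.2]
    omega⟩

theorem KoszulIndex.le_insert {k i : ℕ} (S : KoszulIndex k (i + 1)) (t : {t : Fin k // t ∉ S.1}) :
    S.1 ≤ (S.insert t).1 :=
  Finset.subset_insert t.1 S.1

/-- The sign `(-1) ^ j`, where `j` is the position of `t` in the increasing enumeration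
`t_0 < t_1 < ...` of the complement of `S`. -/
def koszulSign {k : ℕ} (S : Finset (Fin k)) (t : Fin k) : ℤ :=
  (-1) ^ (Sᶜ.filter (· < t)).card

/-- The Koszul complex in degree `i`: the direct sum of the `X(S)` over the `S` with `k - i`
elements. -/
abbrev KoszulObj {K : Type u} [Field K] {k : ℕ}
    (X : Cube k (ModuleCat.{u} K)) (i : ℕ) : Type u := ⨁ S : KoszulIndex k i, X.obj S.1

/-- The differential, given on the summand `X(S)` by the sum over `t ∉ S` of `(-1) ^ j` times
`X(S ⊆ S ∪ {t})`, where `t = t_j`. -/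
def koszulD {K : Type u} [Field K] {k : ℕ}
    (X : Cube k (ModuleCat.{u} K)) (i : ℕ) : KoszulObj X (i + 1) →ₗ[K] KoszulObj X i :=
  DirectSum.toModule K (KoszulIndex k (i + 1)) (KoszulObj X i) fun S =>
    ∑ t : {t : Fin k // t ∉ S.1}, koszulSign S.1 t.1 •
      (DirectSum.lof K (KoszulIndex k i) (fun T => X.obj T.1) (S.insert t) ∘ₗ
        (X.map (homOfLE (S.le_insert t))).hom)

theorem koszulSign_insert {k : ℕ} (S : Finset (Fin k)) (t u : Fin k) (ht : t ∉ S) :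
    koszulSign (Insert.insert t S) u = if t < u then -koszulSign S u else koszulSign S u := by
  unfold koszulSign
  have h1 : (Insert.insert t S)ᶜ.filter (· < u) = (Sᶜ.filter (· < u)).erase t := by
    ext s
    simp only [Finset.mem_filter, Finset.mem_compl, Finset.mem_insert, Finset.mem_erase]
    tauto
  rw [h1]
  split_ifs with h
  · have hm : t ∈ Sᶜ.filter (· < u) := by simp [ht, h]
    rw [← Finset.card_erase_add_one hm, pow_succ]
    simp
  · rw [Finset.erase_eq_of_notMem]
    simp [h]

theorem koszulSign_swap {k : ℕ} (S : Finset (Fin k)) (t u : Fin k) (ht : t ∉ S) (hu : u ∉ S)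
    (h : t ≠ u) :
    koszulSign S t * koszulSign (Insert.insert t S) u +
      koszulSign S u * koszulSign (Insert.insert u S) t = 0 := by
  rw [koszulSign_insert S t u ht, koszulSign_insert S u t hu]
  rcases lt_or_gt_of_ne h with h' | h'
  · rw [if_pos h', if_neg (not_lt.2 h'.le)]
    ring
  · rw [if_pos h', if_neg (not_lt.2 h'.le)]
    ring

theorem koszulD_lof {K : Type u} [Field K] {k : ℕ} (X : Cube k (ModuleCat.{u} K)) (i : ℕ)
    (S : KoszulIndex k (i + 1)) (x : X.obj S.1) :
    koszulD X i (DirectSum.lof K _ (fun T : KoszulIndex k (i + 1) => X.obj T.1) S x) =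
      ∑ t : {t : Fin k // t ∉ S.1}, koszulSign S.1 t.1 •
        DirectSum.lof K (KoszulIndex k i) (fun T => X.obj T.1) (S.insert t)
          ((X.map (homOfLE (S.le_insert t))).hom x) := by
  rw [koszulD, DirectSum.toModule_lof]
  simp

theorem koszul_lof_congr {K : Type u} [Field K] {k : ℕ} (X : Cube k (ModuleCat.{u} K)) (i : ℕ)
    {S A A' : Finset (Fin k)} (x : X.obj S) {T T' : KoszulIndex k i} (f : S ⟶ A) (g : A ⟶ T.1)
    (f' : S ⟶ A') (g' : A' ⟶ T'.1) (h : T = T') :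
    DirectSum.lof K (KoszulIndex k i) (fun T => X.obj T.1) T
        ((X.map g).hom ((X.map f).hom x)) =
      DirectSum.lof K (KoszulIndex k i) (fun T => X.obj T.1) T'
        ((X.map g').hom ((X.map f').hom x)) := by
  subst h
  rw [← ModuleCat.comp_apply, ← ModuleCat.comp_apply, ← X.map_comp, ← X.map_comp,
    Subsingleton.elim (f ≫ g) (f' ≫ g')]

theorem koszulD_comp {K : Type u} [Field K] {k : ℕ} (X : Cube k (ModuleCat.{u} K)) (i : ℕ) :
    koszulD X i ∘ₗ koszulD X (i + 1) = 0 := by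
  refine DirectSum.linearMap_ext K fun S => LinearMap.ext fun x => ?_
  simp only [LinearMap.comp_apply, LinearMap.zero_apply]
  rw [koszulD_lof, map_sum]
  simp only [map_zsmul, koszulD_lof, Finset.smul_sum, smul_smul]
  rw [Finset.sum_sigma']
  have hne : ∀ p : (t : {t : Fin k // t ∉ S.1}) × {u : Fin k // u ∉ (S.insert t).1},
      p.2.1 ∉ S.1 ∧ p.1.1 ≠ p.2.1 := fun p => by
    have h := p.2.2
    simp only [KoszulIndex.insert, Finset.mem_insert, not_or] at h
    exact ⟨h.2, fun e => h.1 e.symm⟩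
  refine Finset.sum_involution
    (fun p _ => ⟨⟨p.2.1, (hne p).1⟩, ⟨p.1.1, by
      simp only [KoszulIndex.insert, Finset.mem_insert, not_or]
      exact ⟨(hne p).2, p.1.2⟩⟩⟩) ?_ ?_ ?_ ?_
  · rintro ⟨t, u⟩ -
    have h := hne ⟨t, u⟩
    have e := koszulSign_swap S.1 t.1 u.1 t.2 h.1 h.2
    have ht : t.1 ∉ (S.insert ⟨u.1, h.1⟩).1 := by
      simp only [KoszulIndex.insert, Finset.mem_insert, not_or]
      exact ⟨h.2, t.2⟩
    have c := koszul_lof_congr X i x (T := (S.insert t).insert u)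
      (T' := (S.insert ⟨u.1, h.1⟩).insert ⟨t.1, ht⟩)
      (homOfLE (S.le_insert t)) (homOfLE ((S.insert t).le_insert u))
      (homOfLE (S.le_insert ⟨u.1, h.1⟩)) (homOfLE ((S.insert ⟨u.1, h.1⟩).le_insert ⟨t.1, ht⟩))
      (Subtype.ext (Finset.insert_comm _ _ _))
    refine (congrArg₂ (· + ·) (congrArg (_ • ·) c) rfl).trans ?_
    refine (add_smul _ _ _).symm.trans ?_
    exact (congrArg (· • _) e).trans (zero_smul ℤ _)
  · rintro ⟨t, u⟩ - - heq
    exact (hne ⟨t, u⟩).2 (congrArg (fun p => p.1.1) heq).symm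
  · intros
    exact Finset.mem_sigma.2 ⟨Finset.mem_univ _, Finset.mem_univ _⟩
  · intros
    rfl

/-- The Koszul complex of a cube of vector spaces. -/
def koszulComplex {K : Type u} [Field K] {k : ℕ} (X : Cube k (ModuleCat.{u} K)) :
    ChainComplex (ModuleCat.{u} K) ℕ :=
  ChainComplex.of (fun i => ModuleCat.of K (KoszulObj X i))
    (fun i => ModuleCat.ofHom (koszulD X i))
    (fun i => by
      rw [← ModuleCat.ofHom_comp, koszulD_comp]
      rfl)

/-- A persistence module `F` is `k`-middle-exact if, for every strongly bicartesian `k`-cube in `P`,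
the Koszul complex of its image under `F` has trivial homology in all degrees `0 < i < k`. -/
def IsMiddleExact {K : Type u} [Field K] {P : Type v} [PartialOrder P] (k : ℕ)
    (F : P ⥤ ModuleCat.{u} K) : Prop :=
  ∀ X : Cube k P, IsStronglyBicartesian X →
    ∀ i : ℕ, 0 < i → i < k → IsZero ((koszulComplex (X ⋙ F)).homology i)

/-- The product of a finite family of total orders, with the product partial order. -/
def ProductPoset {N : ℕ} (S : Fin N → Type v) : Type v := ∀ j, S j

instance {N : ℕ} (S : Fin N → Type v) [∀ j, LinearOrder (S j)] :
    PartialOrder (ProductPoset S) :=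
  inferInstanceAs (PartialOrder (∀ j, S j))

end Persistence

end

noncomputable section

namespace Persistence

/-! ### Structure maps -/

section Transition

variable {K : Type u} [Field K] {P : Type v} [PartialOrder P]

/-! Box modules are split off one at a time. A nonzero `F` turns out to have a summand supported on
a box `[a, b]`, and induction on the total dimension finishes the proof. Such a summand is given by
an element `u` of `F(a)` which dies outside the box and a functional on `F(b)` which kills
everything born outside the box and is `1` on the image of `u` (`HasBoxGenerator`).

Middle-exactness enters only through two consequences for coordinate cubes. Exactness in degree `k -
1`, next to the initial vertex, says that an element of `F(x)` dying in the directions `σ` lifts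
along any direction outside `σ` to an element that still dies in those directions (`HasLifting`).
Exactness in degree `1`, next to the terminal vertex, gives the dual statement about images
(`HasDescent`). Unlike a statement about all strongly bicartesian cubes in the poset, both
conditions visibly pass to retracts of `F`, so the induction can continue.

To find a box, suppose first that some structure map has a kernel. A kernel element pushed up as far
as it survives becomes a socle element `v` at a point `y` which is not the greatest point. If at
least two coordinates of `y` are nonmaximal, then `v` lifts along every coordinate, and the box runs
from the least point to `y`. If only `j` is nonmaximal, then `v` lifts along all coordinates but
`j`, and the box starts as far down in direction `j` as a lift exists. If instead all structure maps
are injective, take a nonzero element at a minimal point `a` of the support. Descent shows that its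
image at the greatest point is not a combination of elements born outside the up-set of `a`, so the
box runs from `a` to the greatest point. -/

/-- The structure map of a persistence module from `x` to `y`. -/
def transition (F : P ⥤ ModuleCat.{u} K) {x y : P} (h : x ≤ y) : F.obj x →ₗ[K] F.obj y :=
  (F.map (homOfLE h)).hom

@[simp]
theorem transition_self (F : P ⥤ ModuleCat.{u} K) {x : P} (h : x ≤ x) (v : F.obj x) :
    transition F h v = v := by
  have : F.map (homOfLE h) = 𝟙 _ := F.map_id x
  rw [transition, this]
  rfl

@[simp]
theorem transition_transition (F : P ⥤ ModuleCat.{u} K) {x y z : P} (h : x ≤ y) (h' : y ≤ z)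
    (v : F.obj x) : transition F h' (transition F h v) = transition F (h.trans h') v := by
  have : F.map (homOfLE (h.trans h')) = F.map (homOfLE h) ≫ F.map (homOfLE h') := by
    rw [← F.map_comp]
    rfl
  simp [transition, this]

theorem transition_naturality {F G : P ⥤ ModuleCat.{u} K} (f : F ⟶ G) {x y : P} (h : x ≤ y)
    (v : F.obj x) :
    (f.app y).hom (transition F h v) = transition G h ((f.app x).hom v) := by
  exact congrArg (fun g => (ModuleCat.Hom.hom g) v) (f.naturality (homOfLE h))

end Transition

/-! ### Coordinate cubes -/

section CoordinateCube

variable {N : ℕ} {S : Fin N → Type v}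

/-- The point with the coordinates of `a` in `T` and those of `b` outside `T`. -/
def mix (T : Finset (Fin N)) (a b : ProductPoset S) : ProductPoset S :=
  fun i => if i ∈ T then a i else b i

theorem mix_of_mem {T : Finset (Fin N)} (a b : ProductPoset S) {i : Fin N} (h : i ∈ T) :
    mix T a b i = a i := if_pos h

theorem mix_of_notMem {T : Finset (Fin N)} (a b : ProductPoset S) {i : Fin N} (h : i ∉ T) :
    mix T a b i = b i := if_neg h

theorem mix_insert_of_ne (T : Finset (Fin N)) (x y : ProductPoset S) {i j : Fin N} (h : i ≠ j) :
    mix (insert j T) x y i = mix T x y i := by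
  simp [mix, h]

variable [∀ j, LinearOrder (S j)]

/-- The cube spanned by `lo ≤ hi` in the coordinate directions `e 0, …, e (k - 1)`. -/
def coordinateCube {k : ℕ} (e : Fin k ↪ Fin N) {lo hi : ProductPoset S} (h : lo ≤ hi) :
    Cube k (ProductPoset S) :=
  Monotone.functor (f := fun A : Finset (Fin k) => mix (A.map e) hi lo) fun A B hAB i => by
    change mix (A.map e) hi lo i ≤ mix (B.map e) hi lo i
    by_cases hA : i ∈ A.map e
    · rw [mix_of_mem _ _ hA, mix_of_mem _ _ (Finset.map_subset_map.2 hAB hA)]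
    · rw [mix_of_notMem _ _ hA]
      by_cases hB : i ∈ B.map e
      · rw [mix_of_mem _ _ hB]
        exact h i
      · rw [mix_of_notMem _ _ hB]

theorem coordinateCube_obj {k : ℕ} (e : Fin k ↪ Fin N) {lo hi : ProductPoset S} (h : lo ≤ hi)
    (A : Finset (Fin k)) : (coordinateCube e h).obj A = mix (A.map e) hi lo := rfl

/-- Limits and colimits in a poset are meets and joins. The vertices `A ∪ {t}` and `A` differ only
in coordinate `e t`, so two distinct `t` in `B \ A` already bound every coordinate; dually for `B \
{t}`. No strictness of `lo ≤ hi` is needed, so degenerate cubes are allowed. -/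
theorem isStronglyBicartesian_coordinateCube {k : ℕ} (e : Fin k ↪ Fin N)
    {lo hi : ProductPoset S} (h : lo ≤ hi) : IsStronglyBicartesian (coordinateCube e h) := by
  refine ⟨fun A B hAB hc => ⟨?_⟩, fun A B hAB hc => ⟨?_⟩⟩
  · have key : ∀ s : Cone ((Subtype.mono_coe (· ∈ Set.Ioc A B)).functor ⋙ coordinateCube e h),
        s.pt ≤ (coordinateCube e h).obj A := by
      intro s i
      rw [coordinateCube_obj]
      have hs : ∀ t ∈ B \ A, s.pt ≤ mix ((insert t A).map e) hi lo := fun t ht => by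
        rw [Finset.mem_sdiff] at ht
        exact leOfHom (s.π.app ⟨insert t A, Finset.ssubset_insert ht.2,
          Finset.insert_subset ht.1 hAB⟩)
      obtain ⟨t₁, h₁, t₂, h₂, hne⟩ := Finset.one_lt_card.1 hc
      have : ∃ t ∈ B \ A, i ≠ e t := by
        by_cases hi₁ : i = e t₁
        · exact ⟨t₂, h₂, fun hi₂ => hne (e.injective (hi₁.symm.trans hi₂))⟩
        · exact ⟨t₁, h₁, hi₁⟩
      obtain ⟨t, ht, hit⟩ := this
      refine (hs t ht i).trans (le_of_eq ?_)
      simp only [mix, Finset.map_insert, Finset.mem_insert, hit, false_or]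
    exact { lift := fun s => homOfLE (key s), fac := fun _ _ => Subsingleton.elim _ _,
            uniq := fun _ _ _ => Subsingleton.elim _ _ }
  · have key : ∀ s : Cocone ((Subtype.mono_coe (· ∈ Set.Ico A B)).functor ⋙ coordinateCube e h),
        (coordinateCube e h).obj B ≤ s.pt := by
      intro s i
      rw [coordinateCube_obj]
      have hs : ∀ t ∈ B \ A, mix ((B.erase t).map e) hi lo ≤ s.pt := fun t ht => by
        rw [Finset.mem_sdiff] at ht
        exact leOfHom (s.ι.app ⟨B.erase t, Finset.subset_erase.2 ⟨hAB, ht.2⟩,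
          Finset.erase_ssubset ht.1⟩)
      obtain ⟨t₁, h₁, t₂, h₂, hne⟩ := Finset.one_lt_card.1 hc
      have : ∃ t ∈ B \ A, i ≠ e t := by
        by_cases hi₁ : i = e t₁
        · exact ⟨t₂, h₂, fun hi₂ => hne (e.injective (hi₁.symm.trans hi₂))⟩
        · exact ⟨t₁, h₁, hi₁⟩
      obtain ⟨t, ht, hit⟩ := this
      refine (le_of_eq ?_).trans (hs t ht i)
      simp only [mix, Finset.map_erase, Finset.mem_erase, ne_eq, hit, not_false_eq_true, true_and]
    exact { desc := fun s => homOfLE (key s), fac := fun _ _ => Subsingleton.elim _ _,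
            uniq := fun _ _ _ => Subsingleton.elim _ _ }

end CoordinateCube

/-! ### Components of the Koszul differential -/

section Koszul

variable {K : Type u} [Field K]

theorem koszulD_exact_of_isZero_homology {k : ℕ} (X : Cube k (ModuleCat.{u} K)) (i : ℕ)
    (h : IsZero ((koszulComplex X).homology (i + 1))) (z : KoszulObj X (i + 1))
    (hz : koszulD X i z = 0) : ∃ w, koszulD X (i + 1) w = z := by
  have h1 := ((koszulComplex X).exactAt_iff_isZero_homology (i + 1)).2 h
  rw [(koszulComplex X).exactAt_iff' (i + 2) (i + 1) i (by simp) (by simp),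
    ShortComplex.moduleCat_exact_iff] at h1
  have h2 : ∀ j, (koszulComplex X).d (j + 1) j = ModuleCat.ofHom (koszulD X j) :=
    fun j => ChainComplex.of_d (fun i => ModuleCat.of K (KoszulObj X i))
      (fun i => ModuleCat.ofHom (koszulD X i)) j
  obtain ⟨w, hw⟩ := h1 z (by
    change ((koszulComplex X).d (i + 1) i).hom z = 0
    rw [h2]
    exact hz)
  refine ⟨w, ?_⟩
  change ((koszulComplex X).d (i + 1 + 1) (i + 1)).hom w = z at hw
  rw [h2] at hw
  exact hw

theorem koszulIndex_insert_injective {k i : ℕ} (S : KoszulIndex k (i + 1))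
    {t t' : {t : Fin k // t ∉ S.1}} (h : S.insert t = S.insert t') : t = t' := by
  have h' : insert t.1 S.1 = insert t'.1 S.1 := congrArg Subtype.val h
  have : t.1 ∈ insert t'.1 S.1 := h' ▸ Finset.mem_insert_self _ _
  exact Subtype.ext ((Finset.mem_insert.1 this).resolve_right t.2)

theorem component_koszulD_lof {k : ℕ} (X : Cube k (ModuleCat.{u} K)) (i : ℕ)
    (S : KoszulIndex k (i + 1)) (t : {t : Fin k // t ∉ S.1}) (x : X.obj S.1) :
    DirectSum.component K (KoszulIndex k i) (fun T => X.obj T.1) (S.insert t)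
        (koszulD X i (DirectSum.lof K _ (fun T : KoszulIndex k (i + 1) => X.obj T.1) S x)) =
      koszulSign S.1 t.1 • (X.map (homOfLE (S.le_insert t))).hom x := by
  rw [koszulD_lof, map_sum, Finset.sum_eq_single t]
  · rw [map_zsmul, DirectSum.component.lof_self]
  · intro t' _ ht'
    rw [map_zsmul, DirectSum.component.of, dif_neg, smul_zero]
    exact fun h => ht' (koszulIndex_insert_injective S h)
  · simp

/-- A component of a boundary at `T` is a signed sum of elements coming from the predecessors `T \
{t}`, so it lies in any subspace containing the images from below. -/
theorem component_koszulD_mem {k : ℕ} (X : Cube k (ModuleCat.{u} K)) (i : ℕ)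
    (T : KoszulIndex k i) (W : Submodule K (X.obj T.1))
    (hW : ∀ (S : Finset (Fin k)) (h : S ⊂ T.1) (x : X.obj S),
      (X.map (homOfLE h.le)).hom x ∈ W) (w : KoszulObj X (i + 1)) :
    DirectSum.component K (KoszulIndex k i) (fun T => X.obj T.1) T (koszulD X i w) ∈ W := by
  induction w using DirectSum.induction_on with
  | zero => simp
  | add a b ha hb =>
    rw [map_add, map_add]
    exact W.add_mem ha hb
  | of S x =>
    change DirectSum.component K (KoszulIndex k i) (fun T => X.obj T.1) T
      (koszulD X i (DirectSum.lof K _ (fun T : KoszulIndex k (i + 1) => X.obj T.1) S x)) ∈ W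
    by_cases h : ∃ t, S.insert t = T
    · obtain ⟨t, rfl⟩ := h
      rw [component_koszulD_lof]
      exact W.smul_of_tower_mem _ (hW S.1 (Finset.ssubset_insert t.2) x)
    · push Not at h
      rw [koszulD_lof, map_sum]
      refine W.sum_mem fun t _ => ?_
      rw [map_zsmul, DirectSum.component.of, dif_neg (h t), smul_zero]
      exact W.zero_mem

/-- The index of the initial vertex of a cube. -/
def KoszulIndex.bot (k : ℕ) : KoszulIndex k k := ⟨∅, by simp⟩

theorem exists_eq_lof_bot {k : ℕ} (X : Cube k (ModuleCat.{u} K)) (w : KoszulObj X k) :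
    ∃ u : X.obj (KoszulIndex.bot k).1,
      w = DirectSum.lof K _ (fun T : KoszulIndex k k => X.obj T.1) (KoszulIndex.bot k) u := by
  induction w using DirectSum.induction_on with
  | zero => exact ⟨0, (map_zero _).symm⟩
  | add a b ha hb =>
    obtain ⟨a, rfl⟩ := ha
    obtain ⟨b, rfl⟩ := hb
    exact ⟨a + b, (map_add _ _ _).symm⟩
  | of S x =>
    obtain ⟨S, hS⟩ := S
    have : S = ∅ := by
      rw [← Finset.card_eq_zero]
      omega
    subst this
    exact ⟨x, rfl⟩

/-- The index of the vertex with only `t` missing. -/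
def KoszulIndex.compl {k : ℕ} (t : Fin k) : KoszulIndex k 1 := ⟨{t}ᶜ, by
  have := t.pos
  rw [Finset.card_compl]
  simp
  omega⟩

/-- The index of the terminal vertex of a cube. -/
def KoszulIndex.top (k : ℕ) : KoszulIndex k 0 := ⟨Finset.univ, by simp⟩

/-- The complement of the index has the single element `t`, in position `0`, so no sign appears. -/
theorem koszulD_lof_compl {k : ℕ} (X : Cube k (ModuleCat.{u} K)) (t : Fin k)
    (x : X.obj (KoszulIndex.compl t).1) :
    koszulD X 0 (DirectSum.lof K _ (fun T : KoszulIndex k 1 => X.obj T.1)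
        (KoszulIndex.compl t) x) =
      DirectSum.lof K _ (fun T : KoszulIndex k 0 => X.obj T.1) (KoszulIndex.top k)
        ((X.map (homOfLE (Finset.subset_univ _ :
          (KoszulIndex.compl t).1 ≤ (KoszulIndex.top k).1))).hom x) := by
  have ht : t ∉ (KoszulIndex.compl t).1 := by simp [KoszulIndex.compl]
  rw [koszulD_lof, Finset.sum_eq_single ⟨t, ht⟩]
  · have h1 : koszulSign (KoszulIndex.compl t).1 t = 1 := by
      simp [koszulSign, KoszulIndex.compl, Finset.filter_singleton]
    have h2 : (KoszulIndex.compl t).insert ⟨t, ht⟩ = KoszulIndex.top k := by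
      ext s
      simp [KoszulIndex.compl, KoszulIndex.insert, KoszulIndex.top]
    have := koszul_lof_congr X 0 x (𝟙 _) (homOfLE ((KoszulIndex.compl t).le_insert ⟨t, ht⟩))
      (𝟙 _) (homOfLE (Finset.subset_univ _ : _ ≤ (KoszulIndex.top k).1)) h2
    rw [h1, one_smul]
    rw [X.map_id] at this
    exact this
  · intro s _ hs
    refine absurd (Subtype.ext ?_) hs
    have := s.2
    simpa [KoszulIndex.compl] using this
  · simp

end Koszul

/-! ### Lifting and descent of elements -/

section LiftDescent

variable {K : Type u} [Field K] {N : ℕ} {S : Fin N → Type v} [∀ j, LinearOrder (S j)]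

/-- The element `v` of `F(x)` vanishes at all points `z` with `hi i ≤ z i` for some `i ∈ σ`. -/
def DiesAbove (F : ProductPoset S ⥤ ModuleCat.{u} K) (σ : Finset (Fin N)) (hi : ProductPoset S)
    {x : ProductPoset S} (v : F.obj x) : Prop :=
  ∀ (z : ProductPoset S) (h : x ≤ z), (∃ i ∈ σ, hi i ≤ z i) → transition F h v = 0

/-- The subspace of `F(x)` spanned by the images of the `F(z)` with `z i ≤ lo i` for some
`i ∈ σ`. -/
def imageBelow (F : ProductPoset S ⥤ ModuleCat.{u} K) (σ : Finset (Fin N)) (lo x : ProductPoset S) :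
    Submodule K (F.obj x) :=
  ⨆ (z : ProductPoset S) (h : z ≤ x) (_ : ∃ i ∈ σ, z i ≤ lo i), LinearMap.range (transition F h)

/-- Elements which die in the directions `σ` lift along any other coordinate, to elements which
die in the directions `σ`. -/
def HasLifting (F : ProductPoset S ⥤ ModuleCat.{u} K) : Prop :=
  ∀ (σ : Finset (Fin N)) (j : Fin N), j ∉ σ → σ.Nonempty →
    ∀ (x' x hi : ProductPoset S) (h : x' ≤ x), (∀ i, i ≠ j → x' i = x i) →
      (∀ i ∈ σ, x i ≤ hi i) → ∀ v : F.obj x, DiesAbove F σ hi v →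
        ∃ u : F.obj x', transition F h u = v ∧ DiesAbove F σ hi u

/-- Elements which come from below in the directions `σ` after moving along another coordinate
already come from below in the directions `σ`. -/
def HasDescent (F : ProductPoset S ⥤ ModuleCat.{u} K) : Prop :=
  ∀ (σ : Finset (Fin N)) (j : Fin N), j ∉ σ → σ.Nonempty →
    ∀ (x x' lo : ProductPoset S) (h : x ≤ x'), (∀ i, i ≠ j → x' i = x i) →
      (∀ i ∈ σ, lo i ≤ x i) → ∀ v : F.obj x, transition F h v ∈ imageBelow F σ lo x' →
        v ∈ imageBelow F σ lo x

theorem transition_mem_imageBelow (F : ProductPoset S ⥤ ModuleCat.{u} K) {σ : Finset (Fin N)}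
    {lo x z : ProductPoset S} (h : z ≤ x) (hz : ∃ i ∈ σ, z i ≤ lo i) (v : F.obj z) :
    transition F h v ∈ imageBelow F σ lo x :=
  Submodule.mem_iSup_of_mem z <| Submodule.mem_iSup_of_mem h <|
    Submodule.mem_iSup_of_mem hz <| LinearMap.mem_range_self _ _

theorem imageBelow_le (F : ProductPoset S ⥤ ModuleCat.{u} K) {σ : Finset (Fin N)}
    {lo x : ProductPoset S} {W : Submodule K (F.obj x)}
    (H : ∀ (z : ProductPoset S) (h : z ≤ x), (∃ i ∈ σ, z i ≤ lo i) → ∀ v, transition F h v ∈ W) :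
    imageBelow F σ lo x ≤ W :=
  iSup_le fun z => iSup_le fun h => iSup_le fun hz => by
    rintro _ ⟨v, rfl⟩
    exact H z h hz v

theorem transition_mem_imageBelow_of_mem (F : ProductPoset S ⥤ ModuleCat.{u} K)
    {σ : Finset (Fin N)} {lo x y : ProductPoset S} (h : x ≤ y) {v : F.obj x}
    (hv : v ∈ imageBelow F σ lo x) : transition F h v ∈ imageBelow F σ lo y := by
  have : imageBelow F σ lo x ≤ (imageBelow F σ lo y).comap (transition F h) :=
    imageBelow_le F fun z hz hi w => by
      rw [Submodule.mem_comap, transition_transition]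
      exact transition_mem_imageBelow F _ hi w
  exact this hv

/-- An injective enumeration of `insert j σ` with first element `j`. -/
theorem exists_embedding_of_notMem {σ : Finset (Fin N)} {j : Fin N} (hj : j ∉ σ)
    (hσ : σ.Nonempty) : ∃ (m : ℕ) (e : Fin (m + 2) ↪ Fin N), e 0 = j ∧
      (∀ t : Fin (m + 2), t ≠ 0 → e t ∈ σ) ∧ ∀ i ∈ σ, ∃ t : Fin (m + 2), t ≠ 0 ∧ e t = i := by
  obtain ⟨m, hm⟩ : ∃ m, σ.card = m + 1 := Nat.exists_eq_succ_of_ne_zero hσ.card_pos.ne'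
  let f := σ.orderEmbOfFin hm
  have hf : Set.range f = σ := Finset.range_orderEmbOfFin σ hm
  have hinj : Function.Injective (Fin.cons j f : Fin (m + 2) → Fin N) :=
    Fin.cons_injective_iff.2 ⟨by rw [hf]; exact hj, f.injective⟩
  refine ⟨m, ⟨_, hinj⟩, rfl, fun t ht => ?_, fun i hi => ?_⟩
  · obtain ⟨s, rfl⟩ := Fin.exists_succ_eq.2 ht
    exact Finset.orderEmbOfFin_mem σ hm s
  · obtain ⟨s, hs⟩ : i ∈ Set.range f := by
      rw [hf]
      exact hi
    exact ⟨s.succ, Fin.succ_ne_zero s, hs⟩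

/-- Use the cube with bottom vertex `x'`, whose direction `0` raises `j` to reach `x` and whose
other directions raise the coordinates in `σ` to `hi`. Placing `v` at the vertex `{0}` gives a
cycle, because `v` dies at every `{0, t}`. It bounds some `u` at the bottom vertex: the component at
`{0}` says that `u` lifts `v`, and the zero components at `{t}` say that `u` dies. -/
theorem hasLifting_of_isMiddleExact (F : ProductPoset S ⥤ ModuleCat.{u} K)
    (hF : ∀ k : ℕ, 2 ≤ k → k ≤ N → IsMiddleExact k F) : HasLifting F := by
  intro σ j hj hσ x' x hi hx hxj hxi v hv
  obtain ⟨m, e, he0, heσ, hσe⟩ := exists_embedding_of_notMem hj hσ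
  have hmN : m + 2 ≤ N := by simpa using Fintype.card_le_of_embedding e
  -- the upper corner of the cube
  let c : ProductPoset S := mix σ hi x
  have hxc : x ≤ c := fun i => by
    by_cases h : i ∈ σ
    · exact (hxi i h).trans_eq (mix_of_mem _ _ h).symm
    · exact (mix_of_notMem _ _ h).symm.le
  have hlc : x' ≤ c := hx.trans hxc
  let X := coordinateCube e hlc
  have hexact := koszulD_exact_of_isZero_homology (X ⋙ F) m
    (hF (m + 2) (by omega) hmN X (isStronglyBicartesian_coordinateCube e hlc) (m + 1)
      (by omega) (by omega))
  let b : KoszulIndex (m + 2) (m + 2) := KoszulIndex.bot (m + 2)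
  have hb : ∀ t, t ∉ b.1 := fun t => Finset.notMem_empty t
  let s : KoszulIndex (m + 2) (m + 1) := b.insert ⟨0, hb 0⟩
  have hs : s.1 = {0} := rfl
  have hX0 : X.obj b.1 = x' := by
    funext i
    exact mix_of_notMem (T := b.1.map e) c x' (by simp [b, KoszulIndex.bot])
  have hxX : X.obj s.1 = x := by
    funext i
    by_cases h : i = j
    · subst h
      exact (mix_of_mem _ _ (by simp [hs, he0])).trans (mix_of_notMem _ _ hj)
    · refine (mix_of_notMem _ _ ?_).trans (hxj i h)
      simpa [hs, he0] using h
  obtain ⟨w, hw⟩ := hexact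
    (DirectSum.lof K _ (fun T : KoszulIndex (m + 2) (m + 1) => (X ⋙ F).obj T.1) s
      (transition F hxX.ge v)) (by
    rw [koszulD_lof]
    refine Finset.sum_eq_zero fun t _ => ?_
    have ht : t.1 ≠ 0 := fun h => t.2 (Finset.mem_singleton.2 h)
    have : ((X ⋙ F).map (homOfLE (s.le_insert t))).hom (transition F hxX.ge v) = 0 := by
      change transition F (leOfHom (X.map (homOfLE (s.le_insert t)))) (transition F hxX.ge v) = 0
      rw [transition_transition]
      refine hv _ _ ⟨e t.1, heσ _ ht, ?_⟩
      refine (mix_of_mem (T := σ) hi x (heσ _ ht)).symm.trans_le (le_of_eq ?_)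
      exact (mix_of_mem c x' (by simp [KoszulIndex.insert])).symm
    rw [this, map_zero, smul_zero])
  obtain ⟨u, rfl⟩ := exists_eq_lof_bot _ w
  have hcomp : ∀ t, koszulSign b.1 t • ((X ⋙ F).map (homOfLE (b.le_insert ⟨t, hb t⟩))).hom u =
      DirectSum.component K _ (fun T : KoszulIndex (m + 2) (m + 1) => (X ⋙ F).obj T.1)
        (b.insert ⟨t, hb t⟩) (DirectSum.lof K _
          (fun T : KoszulIndex (m + 2) (m + 1) => (X ⋙ F).obj T.1) s
          (transition F hxX.ge v)) := fun t => by
    rw [← hw]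
    exact (component_koszulD_lof (X ⋙ F) (m + 1) b ⟨t, hb t⟩ u).symm
  refine ⟨transition F hX0.le u, ?_, ?_⟩
  · have h0 := hcomp 0
    rw [DirectSum.component.lof_self] at h0
    have hsign : koszulSign b.1 (0 : Fin (m + 2)) = 1 := by simp [koszulSign]
    rw [hsign, one_smul] at h0
    have h1 := congrArg (transition F hxX.le) h0
    rw [transition_transition, transition_self] at h1
    rw [transition_transition, ← h1]
    exact (transition_transition F (leOfHom (X.map (homOfLE (b.le_insert ⟨0, hb 0⟩)))) _ u).symm
  · intro z hz hzi
    obtain ⟨i, hiσ, hiz⟩ := hzi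
    obtain ⟨t, ht, rfl⟩ := hσe i hiσ
    have h0 := hcomp t
    rw [DirectSum.component.of, dif_neg] at h0
    swap
    · intro h
      have h' : ({0} : Finset (Fin (m + 2))) = {t} := congrArg Subtype.val h
      exact ht (Finset.singleton_injective h').symm
    have h1 : ((X ⋙ F).map (homOfLE (b.le_insert ⟨t, hb t⟩))).hom u = 0 := by
      have hu : IsUnit (koszulSign b.1 t) := (isUnit_one.neg).pow _
      obtain ⟨a, ha⟩ := hu
      have := congrArg (fun y => (a⁻¹ : ℤˣ).1 • y) h0
      simpa only [← ha, smul_smul, Units.inv_mul, one_smul, smul_zero] using this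
    -- The vertex `{t}` is the least point above `x'` whose coordinate `e t` has reached `hi`, so
    -- vanishing there gives vanishing at `z`.
    have hle : X.obj (b.insert ⟨t, hb t⟩).1 ≤ z := by
      intro i
      by_cases h : i = e t
      · subst h
        refine le_trans (le_of_eq ?_) hiz
        exact (mix_of_mem _ _ (by simp [KoszulIndex.insert])).trans (mix_of_mem _ _ hiσ)
      · refine le_trans (le_of_eq ?_) (hz i)
        refine mix_of_notMem _ _ ?_
        simpa [KoszulIndex.insert, b, KoszulIndex.bot] using h
    have h2 := congrArg (transition F hle) h1
    rw [map_zero] at h2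
    rw [transition_transition, ← h2]
    exact (transition_transition F (leOfHom (X.map (homOfLE (b.le_insert ⟨t, hb t⟩)))) _ u).symm

/-- In the cube with top vertex `x'` and the coordinates in `σ` lowered to `lo`, the point `x` is
the vertex missing only `0`. By assumption the image of `v` at the top is a sum of images from the
vertices missing some `t ≠ 0`. Subtracting gives a cycle in degree `1`, hence a boundary, whose
component at `x` is `v` and comes from vertices missing a direction of `σ`. -/
theorem hasDescent_of_isMiddleExact (F : ProductPoset S ⥤ ModuleCat.{u} K)
    (hF : ∀ k : ℕ, 2 ≤ k → k ≤ N → IsMiddleExact k F) : HasDescent F := by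
  intro σ j hj hσ x x' lo hx hxj hxi v hv
  obtain ⟨m, e, he0, heσ, hσe⟩ := exists_embedding_of_notMem hj hσ
  have hmN : m + 2 ≤ N := by simpa using Fintype.card_le_of_embedding e
  -- the lower corner of the cube
  let c : ProductPoset S := mix σ lo x
  have hcx : c ≤ x := fun i => by
    by_cases h : i ∈ σ
    · exact (mix_of_mem _ _ h).trans_le (hxi i h)
    · exact (mix_of_notMem _ _ h).le
  have hlc : c ≤ x' := hcx.trans hx
  let X := coordinateCube e hlc
  have hexact := koszulD_exact_of_isZero_homology (X ⋙ F) 0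
    (hF (m + 2) (by omega) hmN X (isStronglyBicartesian_coordinateCube e hlc) 1
      (by omega) (by omega))
  have hXtop : X.obj Finset.univ = x' := by
    funext i
    by_cases h : ∃ t, e t = i
    · exact mix_of_mem _ _ (by simpa using h)
    · refine (mix_of_notMem _ _ (by simpa using h)).trans ?_
      have hiσ : i ∉ σ := fun hi => h ((hσe i hi).imp fun _ => And.right)
      have hij : i ≠ j := fun hi => h ⟨0, he0.trans hi.symm⟩
      exact (mix_of_notMem _ _ hiσ).trans (hxj i hij).symm
  let s : KoszulIndex (m + 2) 1 := KoszulIndex.compl 0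
  have hXs : X.obj s.1 = x := by
    funext i
    by_cases h : i = j
    · subst h
      refine (mix_of_notMem _ _ ?_).trans (mix_of_notMem _ _ hj)
      simp [s, KoszulIndex.compl, ← he0]
    · by_cases hiσ : i ∈ σ
      · obtain ⟨t, ht, rfl⟩ := hσe i hiσ
        refine (mix_of_mem _ _ ?_).trans (hxj _ h)
        simpa [s, KoszulIndex.compl] using ht
      · refine (mix_of_notMem _ _ ?_).trans (mix_of_notMem _ _ hiσ)
        intro hi
        obtain ⟨t, ht, rfl⟩ := Finset.mem_map.1 hi
        exact hiσ (heσ t (by simpa [s, KoszulIndex.compl] using ht))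
  let q := DirectSum.component K _ (fun T : KoszulIndex (m + 2) 1 => (X ⋙ F).obj T.1) s
  let ι := DirectSum.lof K _ (fun T : KoszulIndex (m + 2) 0 => (X ⋙ F).obj T.1)
    (KoszulIndex.top (m + 2))
  -- A point below `x'` with coordinate `e t` at most `lo` lies below the vertex missing `t`. Hence
  -- elements of `imageBelow` are boundaries of chains with no component at `s`.
  have hle : imageBelow F σ lo x' ≤ Submodule.comap (ι ∘ₗ transition F hXtop.ge)
      (Submodule.map (koszulD (X ⋙ F) 0) (LinearMap.ker q)) := by
    refine imageBelow_le F fun z hz hzi w => ?_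
    obtain ⟨i, hiσ, hiz⟩ := hzi
    obtain ⟨t, ht, rfl⟩ := hσe i hiσ
    have hzX : z ≤ X.obj (KoszulIndex.compl t).1 := fun i => by
      by_cases h : i = e t
      · subst h
        refine hiz.trans (le_of_eq ?_)
        refine ((mix_of_notMem _ _ ?_).trans (mix_of_mem _ _ hiσ)).symm
        simp [KoszulIndex.compl]
      · refine (hz i).trans ?_
        rw [← hXtop]
        refine le_of_eq ?_
        change mix _ _ _ i = mix _ _ _ i
        have : ∀ a, e a = i → a ≠ t := fun a ha hat => h (hat ▸ ha.symm)
        have hiff : i ∈ Finset.univ.map e ↔ i ∈ (KoszulIndex.compl t).1.map e := by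
          simp only [Finset.mem_map, Finset.mem_univ, true_and, KoszulIndex.compl,
            Finset.mem_compl, Finset.mem_singleton]
          exact exists_congr fun a => ⟨fun ha => ⟨this a ha, ha⟩, And.right⟩
        by_cases hi : i ∈ Finset.univ.map e
        · rw [mix_of_mem _ _ hi, mix_of_mem _ _ (hiff.1 hi)]
        · rw [mix_of_notMem _ _ hi, mix_of_notMem _ _ (mt hiff.2 hi)]
    refine ⟨DirectSum.lof K _ (fun T : KoszulIndex (m + 2) 1 => (X ⋙ F).obj T.1)
      (KoszulIndex.compl t) (transition F hzX w), ?_, ?_⟩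
    · refine LinearMap.mem_ker.2 ?_
      rw [DirectSum.component.of, dif_neg]
      intro h
      have h' : ({t} : Finset (Fin (m + 2)))ᶜ = {0}ᶜ := congrArg Subtype.val h
      exact ht (Finset.singleton_injective (compl_injective h'))
    · rw [koszulD_lof_compl]
      refine congrArg ι ?_
      refine (transition_transition F _ (leOfHom (X.map (homOfLE (Finset.subset_univ _)))) w).trans ?_
      exact (transition_transition F _ _ w).symm
  obtain ⟨a, ha, hda⟩ := hle hv
  obtain ⟨w, hw⟩ := hexact
    (DirectSum.lof K _ (fun T : KoszulIndex (m + 2) 1 => (X ⋙ F).obj T.1) s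
      (transition F hXs.ge v) - a) (by
    rw [map_sub, hda, koszulD_lof_compl, sub_eq_zero]
    refine congrArg ι ?_
    refine (transition_transition F _ (leOfHom (X.map (homOfLE (Finset.subset_univ _)))) v).trans ?_
    exact (transition_transition F _ _ v).symm)
  have hmem := component_koszulD_mem (X ⋙ F) 1 s (imageBelow F σ lo (X.obj s.1))
    (fun T hT y => by
      obtain ⟨t, hts, htT⟩ := Finset.exists_of_ssubset hT
      have ht : t ≠ 0 := by simpa [s, KoszulIndex.compl] using hts
      refine transition_mem_imageBelow F (leOfHom (X.map (homOfLE hT.le))) ⟨e t, heσ t ht, ?_⟩ y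
      exact ((mix_of_notMem _ _ (by simpa using htT)).trans (mix_of_mem _ _ (heσ t ht))).le) w
  rw [hw, map_sub, DirectSum.component.lof_self, LinearMap.mem_ker.1 ha, sub_zero] at hmem
  have := transition_mem_imageBelow_of_mem F hXs.le hmem
  rwa [transition_transition, transition_self] at this

end LiftDescent

/-! ### Existence of a box summand -/

section Box

variable {K : Type u} [Field K] {N : ℕ} {S : Fin N → Type v} [∀ j, LinearOrder (S j)]

/-- An element `u` of `F(a)` which dies outside the box `[a, b]` and a functional on `F(b)` which
vanishes on everything born outside the box `[a, b]` and takes the value `1` on `u`. -/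
def HasBoxGenerator (F : ProductPoset S ⥤ ModuleCat.{u} K) : Prop :=
  ∃ (a b : ProductPoset S) (hab : a ≤ b) (u : F.obj a) (f : F.obj b →ₗ[K] K),
    f (transition F hab u) = 1 ∧ (∀ (z : ProductPoset S) (h : a ≤ z), ¬z ≤ b →
      transition F h u = 0) ∧
    ∀ (z : ProductPoset S) (h : z ≤ b), ¬a ≤ z → ∀ w, f (transition F h w) = 0

/-- A functional vanishing on `W` but not on the image of `u` exists over a field; it is rescaled to
take the value `1`. -/
theorem hasBoxGenerator_of_notMem {F : ProductPoset S ⥤ ModuleCat.{u} K} {a b : ProductPoset S}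
    (hab : a ≤ b) (u : F.obj a)
    (hu : ∀ (z : ProductPoset S) (h : a ≤ z), ¬z ≤ b → transition F h u = 0)
    (W : Submodule K (F.obj b))
    (hW : ∀ (z : ProductPoset S) (h : z ≤ b), ¬a ≤ z → ∀ w, transition F h w ∈ W)
    (huW : transition F hab u ∉ W) : HasBoxGenerator F := by
  obtain ⟨f, hf, hfW⟩ := W.exists_le_ker_of_notMem huW
  refine ⟨a, b, hab, u, (f (transition F hab u))⁻¹ • f, ?_, hu, fun z h hz w => ?_⟩
  · simp [hf]
  · have : f (transition F h w) = 0 := hfW (hW z h hz w)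
    simp [this]

theorem exists_not_le_of_not_le {x y : ProductPoset S} (h : ¬x ≤ y) : ∃ i, y i < x i := by
  by_contra! H
  exact h H

theorem mix_le_of_le (T : Finset (Fin N)) {lo x : ProductPoset S} (h : lo ≤ x) :
    mix T lo x ≤ x := fun i => by
  by_cases hi : i ∈ T
  · exact (mix_of_mem _ _ hi).trans_le (h i)
  · exact (mix_of_notMem _ _ hi).le

theorem le_mix_of_le (T : Finset (Fin N)) {hi x : ProductPoset S} (h : x ≤ hi) :
    x ≤ mix T hi x := fun i => by
  by_cases hi : i ∈ T
  · exact (h i).trans_eq (mix_of_mem _ _ hi).symm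
  · exact (mix_of_notMem _ _ hi).symm.le

/-- Lifting along all coordinates in `T`. -/
theorem HasLifting.exists_lift {F : ProductPoset S ⥤ ModuleCat.{u} K} (hF : HasLifting F)
    (σ T : Finset (Fin N)) (hT : ∀ t ∈ T, ∃ s ∈ σ, s ≠ t) {lo x hi : ProductPoset S}
    (hlo : lo ≤ x) (hhi : ∀ i ∈ σ, x i ≤ hi i) (v : F.obj x) (hv : DiesAbove F σ hi v) :
    ∃ u : F.obj (mix T lo x), transition F (mix_le_of_le T hlo) u = v ∧ DiesAbove F σ hi u := by
  induction T using Finset.induction_on with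
  | empty =>
    have hx : mix ∅ lo x = x := by
      funext i
      exact mix_of_notMem _ _ (Finset.notMem_empty i)
    refine ⟨transition F hx.ge v, by simp, fun z hz hzi => ?_⟩
    rw [transition_transition]
    exact hv _ _ hzi
  | insert t T htT ih =>
    obtain ⟨u, huv, hu⟩ := ih fun t ht => hT t (Finset.mem_insert_of_mem ht)
    obtain ⟨s, hs, hst⟩ := hT t (Finset.mem_insert_self _ _)
    have hle : mix (insert t T) lo x ≤ mix T lo x := fun i => by
      by_cases hi : i = t
      · subst hi
        refine (mix_of_mem _ _ (Finset.mem_insert_self _ _)).trans_le ((hlo i).trans_eq ?_)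
        exact (mix_of_notMem _ _ htT).symm
      · exact (mix_insert_of_ne T lo x hi).le
    -- The direction `t` may belong to `σ`, so it is dropped from the dying directions before
    -- lifting. The hypothesis on `T` keeps the remaining set nonempty.
    obtain ⟨u', hu', hd⟩ := hF (σ.erase t) t (Finset.notMem_erase _ _)
      ⟨s, Finset.mem_erase.2 ⟨hst, hs⟩⟩ _ _ hi hle (fun i hi => mix_insert_of_ne T lo x hi)
      (fun i hi => (mix_le_of_le T hlo i).trans (hhi i (Finset.mem_of_mem_erase hi))) u
      (fun z hz ⟨i, hi, hiz⟩ => hu z hz ⟨i, Finset.mem_of_mem_erase hi, hiz⟩)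
    refine ⟨u', by rw [← huv, ← hu', transition_transition], ?_⟩
    rintro z hz ⟨i, hiσ, hiz⟩
    by_cases hit : i = t
    · subst hit
      -- Dying in the dropped direction comes for free: once `z` has passed `hi` in that coordinate,
      -- the structure map factors through the point where `u` lives.
      have hz' : mix T lo x ≤ z := fun l => by
        by_cases hl : l = i
        · subst hl
          exact (mix_le_of_le T hlo l).trans ((hhi l hiσ).trans hiz)
        · exact (mix_insert_of_ne T lo x hl).symm.trans_le (hz l)
      have := hu z hz' ⟨i, hiσ, hiz⟩
      rwa [← hu', transition_transition] at this
    · exact hd z hz ⟨i, Finset.mem_erase.2 ⟨hit, hiσ⟩, hiz⟩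

variable [∀ j, Finite (S j)]

theorem exists_successors (y : ProductPoset S) : ∃ hi : ProductPoset S, ∀ i,
    (∃ d, y i < d) → y i < hi i ∧ ∀ d, y i < d → hi i ≤ d := by
  have : ∀ i, ∃ c, (∃ d, y i < d) → y i < c ∧ ∀ d, y i < d → c ≤ d := fun i => by
    by_cases h : ∃ d, y i < d
    · obtain ⟨d, hd⟩ := h
      obtain ⟨c, hc⟩ := (Set.toFinite {d | y i < d}).exists_minimal ⟨d, hd⟩
      exact ⟨c, fun _ => ⟨hc.1, fun e he => le_of_not_gt fun hec => hec.not_ge (hc.2 he hec.le)⟩⟩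
    -- A maximal coordinate has no successor; the value chosen here is irrelevant.
    · exact ⟨y i, fun h' => absurd h' h⟩
  choose c hc using this
  exact ⟨c, hc⟩

theorem exists_predecessors (y : ProductPoset S) : ∃ lo : ProductPoset S, ∀ i,
    (∃ d, d < y i) → lo i < y i ∧ ∀ d, d < y i → d ≤ lo i := by
  have : ∀ i, ∃ c, (∃ d, d < y i) → c < y i ∧ ∀ d, d < y i → d ≤ c := fun i => by
    by_cases h : ∃ d, d < y i
    · obtain ⟨d, hd⟩ := h
      obtain ⟨c, hc⟩ := (Set.toFinite {d | d < y i}).exists_maximal ⟨d, hd⟩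
      exact ⟨c, fun _ => ⟨hc.1, fun e he => le_of_not_gt fun hec => hec.not_ge (hc.2 he hec.le)⟩⟩
    · exact ⟨y i, fun h' => absurd h' h⟩
  choose c hc using this
  exact ⟨c, hc⟩

theorem exists_forall_le (x : ProductPoset S) : ∃ o : ProductPoset S, ∀ y, o ≤ y := by
  have : ∀ i, ∃ c : S i, ∀ d, c ≤ d := fun i => by
    have : Nonempty (S i) := ⟨x i⟩
    exact Finite.exists_min id
  choose o ho using this
  exact ⟨o, fun y i => ho i (y i)⟩

theorem exists_forall_ge (x : ProductPoset S) : ∃ o : ProductPoset S, ∀ y, y ≤ o := by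
  have : ∀ i, ∃ c : S i, ∀ d, d ≤ c := fun i => by
    have : Nonempty (S i) := ⟨x i⟩
    exact Finite.exists_max id
  choose o ho using this
  exact ⟨o, fun y i => ho i (y i)⟩

instance : Finite (ProductPoset S) := inferInstanceAs (Finite (∀ j, S j))

/-- A socle element at a point with at least two nonmaximal coordinates generates a box summand
which starts at the least point. -/
theorem HasLifting.hasBoxGenerator_of_two {F : ProductPoset S ⥤ ModuleCat.{u} K}
    (hF : HasLifting F) {y : ProductPoset S} (v : F.obj y) (hv : v ≠ 0)
    (hdie : ∀ (z : ProductPoset S) (h : y ≤ z), z ≠ y → transition F h v = 0)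
    {i₁ i₂ : Fin N} (hne : i₁ ≠ i₂) (h₁ : ∃ d, y i₁ < d) (h₂ : ∃ d, y i₂ < d) :
    HasBoxGenerator F := by
  classical
  obtain ⟨o, ho⟩ := exists_forall_le y
  obtain ⟨hi, hhi⟩ := exists_successors y
  let σ : Finset (Fin N) := Finset.univ.filter fun i => ∃ d, y i < d
  have hσ : ∀ {i}, i ∈ σ ↔ ∃ d, y i < d := by simp [σ]
  -- With two elements in `σ`, every direction leaves another one in which to die, so `v` lifts to
  -- the least point.
  obtain ⟨u, huv, hu⟩ := hF.exists_lift σ Finset.univ (fun t _ => by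
      by_cases h : i₁ = t
      · exact ⟨i₂, hσ.2 h₂, fun h' => hne (h.trans h'.symm)⟩
      · exact ⟨i₁, hσ.2 h₁, h⟩) (ho y) (fun i hi => (hhi i (hσ.1 hi)).1.le) v
    (fun z hz ⟨i, hiσ, hiz⟩ => hdie z hz fun h => by
      subst h
      exact hiz.not_gt (hhi i (hσ.1 hiσ)).1)
  refine hasBoxGenerator_of_notMem (mix_le_of_le _ (ho y)) u (fun z hz hzy => ?_) ⊥
    (fun z hz hza => ?_) ?_
  · obtain ⟨i, hi⟩ := exists_not_le_of_not_le hzy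
    exact hu z hz ⟨i, hσ.2 ⟨_, hi⟩, (hhi i ⟨_, hi⟩).2 _ hi⟩
  · refine absurd (fun i => ?_) hza
    exact (mix_of_mem _ _ (Finset.mem_univ i)).trans_le (ho z i)
  · rwa [huv, Submodule.mem_bot]

/-- A socle element at a point with exactly one nonmaximal coordinate generates a box summand. -/
theorem HasLifting.hasBoxGenerator_of_one {F : ProductPoset S ⥤ ModuleCat.{u} K}
    (hF : HasLifting F) {y : ProductPoset S} (v : F.obj y) (hv : v ≠ 0)
    (hdie : ∀ (z : ProductPoset S) (h : y ≤ z), z ≠ y → transition F h v = 0)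
    {j : Fin N} (hj : ∃ d, y j < d) (hmax : ∀ i, i ≠ j → ∀ d, d ≤ y i) :
    HasBoxGenerator F := by
  classical
  obtain ⟨o, ho⟩ := exists_forall_le y
  obtain ⟨hi, hhi⟩ := exists_successors y
  have hjhi := hhi j hj
  let A : Set (ProductPoset S) := {a | (∀ i, i ≠ j → a i = o i) ∧ ∃ (h : a ≤ y) (u : F.obj a),
    transition F h u = v ∧ DiesAbove F {j} hi u}
  have hvd : DiesAbove F {j} hi v := by
    rintro z hz ⟨i, hij, hiz⟩
    rw [Finset.mem_singleton] at hij
    subst hij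
    refine hdie z hz fun h => ?_
    subst h
    exact hiz.not_gt hjhi.1
  have hlift : ∀ (q : ProductPoset S) (hq : q ≤ y) (w : F.obj q), transition F hq w = v →
      DiesAbove F {j} hi w → mix {j}ᶜ o q ∈ A := fun q hq w hwv hw => by
    obtain ⟨u, huw, hu⟩ := hF.exists_lift {j} {j}ᶜ (fun t ht => ⟨j, by simp, by
      rintro rfl
      simp at ht⟩) (ho q) (fun i hi => by
        rw [Finset.mem_singleton] at hi
        subst hi
        exact (hq i).trans hjhi.1.le) w hw
    refine ⟨fun i hi => mix_of_mem _ _ (by simpa using hi), (mix_le_of_le _ (ho q)).trans hq, u,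
      ?_, hu⟩
    rw [← hwv, ← huw, transition_transition]
  obtain ⟨a, ⟨hao, hay, u, huv, hu⟩, hmin⟩ := (Set.toFinite A).exists_minimal
    ⟨_, hlift y le_rfl v (by simp) hvd⟩
  have hdies : ∀ (z : ProductPoset S) (h : a ≤ z), ¬z ≤ y → transition F h u = 0 :=
    fun z hz hzy => by
      obtain ⟨i, hi⟩ := exists_not_le_of_not_le hzy
      by_cases hij : i = j
      · subst hij
        exact hu z hz ⟨i, by simp, hjhi.2 _ hi⟩
      · exact absurd (hmax i hij _) hi.not_ge
  have hlt : ∀ z : ProductPoset S, ¬a ≤ z → z j < a j := fun z hz => by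
    obtain ⟨i, hi⟩ := exists_not_le_of_not_le hz
    by_cases hij : i = j
    · exact hij ▸ hi
    · rw [hao i hij] at hi
      exact absurd (ho z i) hi.not_ge
  by_cases hp : ∃ d, d < a j
  · obtain ⟨p, hp'⟩ := exists_predecessors a
    obtain ⟨hpa, hpmax⟩ := hp' j hp
    have hqj : mix {j} p y j = p j := mix_of_mem _ _ (by simp)
    have hqi : ∀ i, i ≠ j → mix {j} p y i = y i := fun i hi => mix_of_notMem _ _ (by simpa using hi)
    have hq : mix {j} p y ≤ y := fun i => by
      by_cases hij : i = j
      · subst hij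
        rw [hqj]
        exact hpa.le.trans (hay i)
      · exact (hqi i hij).le
    -- All points below `y` outside the up-set of `a` lie below `mix {j} p y`, which lowers `j` just
    -- past `a`, so the image from this one point suffices. A preimage of `v` there would lift along
    -- the other coordinates and contradict minimality of `a`.
    refine hasBoxGenerator_of_notMem hay u hdies (LinearMap.range (transition F hq))
      (fun z hz hza w => ?_) ?_
    · have hzq : z ≤ mix {j} p y := fun i => by
        by_cases hij : i = j
        · subst hij
          rw [hqj]
          exact hpmax _ (hlt z hza)
        · rw [hqi i hij]
          exact hz i
      exact ⟨transition F hzq w, transition_transition F _ _ _⟩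
    · rw [huv]
      rintro ⟨w, hw⟩
      have hwd : DiesAbove F {j} hi w := by
        rintro z hz ⟨i, hij, hiz⟩
        rw [Finset.mem_singleton] at hij
        subst hij
        have hyz : y ≤ z := fun l => by
          by_cases hl : l = i
          · subst hl
            exact hjhi.1.le.trans hiz
          · exact (hqi l hl).symm.trans_le (hz l)
        have := hvd z hyz ⟨i, by simp, hiz⟩
        rwa [← hw, transition_transition] at this
      have hmem := hlift _ hq w hw hwd
      have hj' : mix {j}ᶜ o (mix {j} p y) j = p j := by
        rw [mix_of_notMem _ _ (by simp), hqj]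
      have hle : mix {j}ᶜ o (mix {j} p y) ≤ a := fun i => by
        by_cases hij : i = j
        · subst hij
          rw [hj']
          exact hpa.le
        · rw [hao i hij]
          exact (mix_of_mem _ _ (by simpa using hij)).le
      have := hmin hmem hle j
      rw [hj'] at this
      exact this.not_gt hpa
  · refine hasBoxGenerator_of_notMem hay u hdies ⊥ (fun z hz hza => absurd ⟨_, hlt z hza⟩ hp) ?_
    rwa [huv, Submodule.mem_bot]

/-- If all structure maps are injective, then there is a box summand which ends at the greatest
point. -/
theorem HasDescent.hasBoxGenerator_of_injective {F : ProductPoset S ⥤ ModuleCat.{u} K}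
    (hF : HasDescent F)
    (hinj : ∀ (x y : ProductPoset S) (h : x ≤ y) (v : F.obj x), transition F h v = 0 → v = 0)
    {x₀ : ProductPoset S} (v₀ : F.obj x₀) (hv₀ : v₀ ≠ 0) : HasBoxGenerator F := by
  classical
  obtain ⟨a, ⟨u, hu⟩, hmin⟩ := (Set.toFinite {x : ProductPoset S | ∃ u : F.obj x, u ≠ 0}).exists_minimal
    ⟨x₀, v₀, hv₀⟩
  obtain ⟨tp, htp⟩ := exists_forall_ge a
  obtain ⟨lo, hlo⟩ := exists_predecessors a
  let σ : Finset (Fin N) := Finset.univ.filter fun i => ∃ d, d < a i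
  have hσ : ∀ {i}, i ∈ σ ↔ ∃ d, d < a i := by simp [σ]
  -- The coordinates are raised to the top one at a time. At `a` itself nothing comes from below,
  -- since `F` vanishes at points strictly below `a`.
  have key : ∀ T : Finset (Fin N), transition F (le_mix_of_le T (htp a)) u ∉
      imageBelow F σ lo (mix T tp a) := by
    intro T
    induction T using Finset.induction_on with
    | empty =>
      intro h
      have hbot : imageBelow F σ lo (mix ∅ tp a) ≤ ⊥ := imageBelow_le F fun z hz ⟨i, hi, hiz⟩ w => by
        have hza : z ≤ a := fun l => (hz l).trans_eq (mix_of_notMem _ _ (Finset.notMem_empty l))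
        have hw : w = 0 := by
          by_contra hw
          exact (hmin ⟨w, hw⟩ hza i).not_gt (hiz.trans_lt (hlo i (hσ.1 hi)).1)
        rw [hw, map_zero]
        exact Submodule.zero_mem _
      exact hu (hinj _ _ _ _ ((Submodule.mem_bot K).1 (hbot h)))
    | insert j T hjT ih =>
      intro h
      refine ih ?_
      have hxj : ∀ i, i ≠ j → mix (insert j T) tp a i = mix T tp a i :=
        fun i hi => mix_insert_of_ne T tp a hi
      have hle : mix T tp a ≤ mix (insert j T) tp a := fun i => by
        by_cases hi : i = j
        · subst hi
          exact (htp _ i).trans_eq (mix_of_mem _ _ (Finset.mem_insert_self _ _)).symm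
        · exact (hxj i hi).ge
      -- A generator that is low in coordinate `j` factors through the point before `j` was raised.
      -- The rest is low in a direction of `σ.erase j`, to which descent along `j` applies.
      have hsup : imageBelow F σ lo (mix (insert j T) tp a) ≤
          imageBelow F (σ.erase j) lo (mix (insert j T) tp a) ⊔
            (imageBelow F σ lo (mix T tp a)).map (transition F hle) :=
        imageBelow_le F fun z hz ⟨i, hi, hiz⟩ w => by
          by_cases hij : i = j
          · subst hij
            have hz' : z ≤ mix T tp a := fun l => by
              by_cases hl : l = i
              · subst hl
                exact (hiz.trans_lt (hlo l (hσ.1 hi)).1).le.trans (le_mix_of_le T (htp a) l)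
              · exact (hz l).trans_eq (hxj l hl)
            exact Submodule.mem_sup_right ⟨transition F hz' w,
              transition_mem_imageBelow F hz' ⟨i, hi, hiz⟩ w, transition_transition F _ _ _⟩
          · exact Submodule.mem_sup_left
              (transition_mem_imageBelow F hz ⟨i, Finset.mem_erase.2 ⟨hij, hi⟩, hiz⟩ w)
      obtain ⟨p, hp, _, ⟨q, hq, rfl⟩, hpq⟩ := Submodule.mem_sup.1 (hsup h)
      have hsub : transition F hle (transition F (le_mix_of_le T (htp a)) u - q) = p := by
        rw [map_sub, transition_transition, ← hpq, add_sub_cancel_right]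
      by_cases hne : (σ.erase j).Nonempty
      · have hd := hF (σ.erase j) j (Finset.notMem_erase _ _) hne _ _ lo hle hxj
          (fun i hi => (hlo i (hσ.1 (Finset.mem_of_mem_erase hi))).1.le.trans
            (le_mix_of_le T (htp a) i)) _ (hsub.symm ▸ hp)
        have hmono : imageBelow F (σ.erase j) lo (mix T tp a) ≤ imageBelow F σ lo (mix T tp a) :=
          imageBelow_le F fun z hz ⟨i, hi, hiz⟩ w =>
            transition_mem_imageBelow F hz ⟨i, Finset.mem_of_mem_erase hi, hiz⟩ w
        exact (Submodule.sub_mem_iff_left _ hq).1 (hmono hd)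
      -- Descent requires a nonempty set of directions; in the empty case the subspace is zero and
      -- injectivity replaces it.
      · have hbot : imageBelow F (σ.erase j) lo (mix (insert j T) tp a) ≤ ⊥ :=
          imageBelow_le F fun z hz ⟨i, hi, _⟩ w => absurd ⟨i, hi⟩ hne
        have := hinj _ _ _ _ (hsub.trans ((Submodule.mem_bot K).1 (hbot hp)))
        rwa [sub_eq_zero.1 this]
  refine hasBoxGenerator_of_notMem (le_mix_of_le Finset.univ (htp a)) u (fun z _ hz => ?_)
    (imageBelow F σ lo (mix Finset.univ tp a)) (fun z hz hza w => ?_) (key Finset.univ)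
  · refine absurd (fun i => ?_) hz
    exact (htp z i).trans_eq (mix_of_mem _ _ (Finset.mem_univ i)).symm
  · obtain ⟨i, hi⟩ := exists_not_le_of_not_le hza
    exact transition_mem_imageBelow F hz ⟨i, hσ.2 ⟨_, hi⟩, (hlo i ⟨_, hi⟩).2 _ hi⟩ w

theorem hasBoxGenerator {F : ProductPoset S ⥤ ModuleCat.{u} K} (hL : HasLifting F)
    (hD : HasDescent F) {x₀ : ProductPoset S} (v₀ : F.obj x₀) (hv₀ : v₀ ≠ 0) :
    HasBoxGenerator F := by
  by_cases hinj : ∀ (x y : ProductPoset S) (h : x ≤ y) (v : F.obj x), transition F h v = 0 → v = 0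
  · exact hD.hasBoxGenerator_of_injective hinj v₀ hv₀
  push Not at hinj
  obtain ⟨x, x', hx, v, hvx', hv⟩ := hinj
  -- A maximal point to which `v` survives turns `v` into a socle element. This point is not the
  -- greatest one, since `v` has already died at `x'`.
  obtain ⟨y, ⟨hxy, hvy⟩, hmax⟩ := (Set.toFinite
    {y : ProductPoset S | ∃ h : x ≤ y, transition F h v ≠ 0}).exists_maximal
      ⟨x, le_rfl, by simpa using hv⟩
  have hdie : ∀ (z : ProductPoset S) (h : y ≤ z), z ≠ y →
      transition F h (transition F hxy v) = 0 := fun z hz hne => by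
    rw [transition_transition]
    by_contra h0
    exact hne (le_antisymm (hmax ⟨_, h0⟩ hz) hz)
  obtain ⟨j, hj⟩ : ∃ j, ∃ d, y j < d := by
    by_contra! H
    have hx'y : x' ≤ y := fun i => H i _
    refine hvy ?_
    rw [← transition_transition F hx hx'y, hvx', map_zero]
  by_cases h : ∃ i, i ≠ j ∧ ∃ d, y i < d
  · obtain ⟨i, hij, hi⟩ := h
    exact hL.hasBoxGenerator_of_two _ hvy hdie hij hi hj
  · push Not at h
    exact hL.hasBoxGenerator_of_one _ hvy hdie hj h

end Box

/-! ### Splitting off summands -/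

section Splitting

variable {K : Type u} [Field K]

theorem intervalFiber_eq_zero {P : Type v} [PartialOrder P] {I : PosetInterval P} {x : P}
    (hx : x ∉ I.carrier) (c : intervalFiber K I x) : c = 0 := by
  have h : intervalFiber K I x = ⊥ := if_neg hx
  exact Subtype.ext ((Submodule.mem_bot K).1 (h.le c.2))

theorem intervalMap_val {P : Type v} [PartialOrder P] {I : PosetInterval P} {x y : P}
    (hx : x ∈ I.carrier) (hy : y ∈ I.carrier) (c : intervalFiber K I x) :
    (intervalMap K I x y c).1 = c.1 := by
  rw [intervalMap, dif_pos ⟨hx, hy⟩]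
  rfl

/-- A direct sum of an interval decomposable module and an interval module is interval
decomposable. -/
theorem IsIntervalDecomposable.of_splitting {P : Type v} [PartialOrder P]
    {F F' : P ⥤ ModuleCat.{u} K} (hF' : IsIntervalDecomposable F') (I : PosetInterval P)
    (s : F' ⟶ F) (r : F ⟶ F') (i : intervalModule K I ⟶ F) (p : F ⟶ intervalModule K I)
    (hsr : s ≫ r = 𝟙 F') (hip : i ≫ p = 𝟙 _) (hsp : s ≫ p = 0) (hir : i ≫ r = 0)
    (hid : r ≫ s + p ≫ i = 𝟙 F) : IsIntervalDecomposable F := by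
  obtain ⟨ι, J, ⟨e⟩⟩ := hF'
  let J' : Option ι → PosetInterval P := fun o => o.elim I J
  let inc : ∀ j, intervalModule K (J j) ⟶ F :=
    fun j => Sigma.ι (fun j => intervalModule K (J j)) j ≫ e.inv ≫ s
  let c : Cofan fun o => intervalModule K (J' o) := Cofan.mk F fun o => match o with
    | none => i
    | some j => inc j
  obtain ⟨D, hD⟩ : ∃ D : ∀ t : Cofan fun o => intervalModule K (J' o),
      (∐ fun j => intervalModule K (J j)) ⟶ t.pt, ∀ t j, Sigma.ι _ j ≫ D t = t.inj (some j) :=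
    ⟨fun t => Limits.Sigma.desc fun j => t.inj (some j), fun t j => Sigma.ι_desc _ _⟩
  obtain ⟨E, hE⟩ : ∃ E : ∀ t : Cofan fun o => intervalModule K (J' o),
      intervalModule K I ⟶ t.pt, ∀ t, E t = t.inj none := ⟨fun t => t.inj none, fun _ => rfl⟩
  have hc : IsColimit c := Cofan.IsColimit.mk c
    -- Existence and uniqueness both come from the decomposition of the identity of `F` as `r ≫ s +
    -- p ≫ i`.
    (fun t => r ≫ e.hom ≫ D t + p ≫ E t)
    (fun t o => by
      match o with
      | none =>
        change i ≫ (r ≫ e.hom ≫ D t + p ≫ E t) = t.inj none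
        rw [Preadditive.comp_add, reassoc_of% hir, reassoc_of% hip, zero_comp, zero_add, hE]
      | some j =>
        change (Sigma.ι (fun j => intervalModule K (J j)) j ≫ e.inv ≫ s) ≫
          (r ≫ e.hom ≫ D t + p ≫ E t) = t.inj (some j)
        rw [Preadditive.comp_add, Category.assoc, Category.assoc, reassoc_of% hsr, Category.assoc,
          Category.assoc, reassoc_of% hsp, zero_comp, comp_zero, comp_zero, add_zero,
          e.inv_hom_id_assoc, hD])
    (fun t m hm => by
      have h1 : i ≫ m = E t := (hm none).trans (hE t).symm
      have h2 : e.inv ≫ s ≫ m = D t := Sigma.hom_ext _ _ fun j => by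
        have h3 : inc j ≫ m = Sigma.ι _ j ≫ D t := (hm (some j)).trans (hD t j).symm
        rw [← h3, Category.assoc, Category.assoc]
      rw [← h1, ← h2, e.hom_inv_id_assoc, ← Category.assoc, ← Category.assoc p i m,
        ← Preadditive.add_comp, hid]
      exact (Category.id_comp m).symm)
  exact ⟨Option ι, J', ⟨hc.coconePointUniqueUpToIso (colimit.isColimit _)⟩⟩

theorem isIntervalDecomposable_of_forall_eq_zero {P : Type v} [PartialOrder P]
    {F : P ⥤ ModuleCat.{u} K} (hF : ∀ (x : P) (v : F.obj x), v = 0) :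
    IsIntervalDecomposable F := by
  have h1 : IsZero F := Functor.isZero F fun x => by
    have : Subsingleton (F.obj x) := ⟨fun a b => (hF x a).trans (hF x b).symm⟩
    exact ModuleCat.isZero_of_subsingleton _
  have h2 : IsZero (∐ fun j : PEmpty => intervalModule K (j.elim : PosetInterval P)) := by
    rw [IsZero.iff_id_eq_zero]
    exact Sigma.hom_ext _ _ fun j => j.elim
  exact ⟨PEmpty, fun j => j.elim, ⟨h1.iso h2⟩⟩

variable {N : ℕ} {S : Fin N → Type v} [∀ j, LinearOrder (S j)]

/-! ### Maps between a box module and `F` -/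

/-- The box `[a, b]` as an interval. -/
def boxInterval {a b : ProductPoset S} (hab : a ≤ b) : PosetInterval (ProductPoset S) where
  carrier := Set.Icc a b
  nonempty := ⟨a, le_rfl, hab⟩
  convex _ _ _ hx hy hxz hzy := ⟨hx.1.trans hxz, hzy.trans hy.2⟩
  zigzag _ _ hx hy := (Relation.ReflTransGen.single ⟨hx, ⟨le_rfl, hab⟩, Or.inr hx.1⟩).tail
    ⟨⟨le_rfl, hab⟩, hy, Or.inl hy.1⟩

open Classical in
open Classical in
/-- The component at `x` of the map from a box module to `F` given by an element of `F(a)`. -/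
def boxInclusionApp (F : ProductPoset S ⥤ ModuleCat.{u} K) {a b : ProductPoset S} (hab : a ≤ b)
    (u : F.obj a) (x : ProductPoset S) : intervalFiber K (boxInterval hab) x →ₗ[K] F.obj x :=
  if h : a ≤ x then
    LinearMap.toSpanSingleton K (F.obj x) (transition F h u) ∘ₗ
      (intervalFiber K (boxInterval hab) x).subtype
  else 0

theorem boxInclusionApp_apply (F : ProductPoset S ⥤ ModuleCat.{u} K) {a b : ProductPoset S}
    (hab : a ≤ b) (u : F.obj a) {x : ProductPoset S} (h : a ≤ x)
    (c : intervalFiber K (boxInterval hab) x) :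
    boxInclusionApp F hab u x c = c.1 • transition F h u := by
  rw [boxInclusionApp, dif_pos h]
  rfl

/-- The map from a box module to `F` which is given by an element dying outside the box. -/
def boxInclusion (F : ProductPoset S ⥤ ModuleCat.{u} K) {a b : ProductPoset S} (hab : a ≤ b)
    (u : F.obj a) (hu : ∀ (z : ProductPoset S) (h : a ≤ z), ¬z ≤ b → transition F h u = 0) :
    intervalModule K (boxInterval hab) ⟶ F where
  app x := ModuleCat.ofHom (boxInclusionApp F hab u x)
  naturality x y g := by
    refine ModuleCat.hom_ext (LinearMap.ext fun (c : intervalFiber K (boxInterval hab) x) => ?_)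
    by_cases hx : x ∈ (boxInterval hab).carrier
    · have hax : a ≤ x := hx.1
      have hxy : x ≤ y := leOfHom g
      have hay : a ≤ y := hax.trans hxy
      change boxInclusionApp F hab u y (intervalMap K (boxInterval hab) x y c) =
        transition F hxy (boxInclusionApp F hab u x c)
      rw [boxInclusionApp_apply F hab u hay, boxInclusionApp_apply F hab u hax, map_smul,
        transition_transition]
      by_cases hy : y ∈ (boxInterval hab).carrier
      · rw [intervalMap_val hx hy]
      · rw [hu y hay fun h => hy ⟨hay, h⟩, smul_zero, smul_zero]
    · rw [intervalFiber_eq_zero hx c]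
      exact (map_zero _).trans (map_zero _).symm

open Classical in
open Classical in
/-- The component at `x` of the map from `F` to a box module given by a functional on `F(b)`. -/
def boxProjectionApp (F : ProductPoset S ⥤ ModuleCat.{u} K) {a b : ProductPoset S} (hab : a ≤ b)
    (f : F.obj b →ₗ[K] K) (x : ProductPoset S) :
    F.obj x →ₗ[K] intervalFiber K (boxInterval hab) x :=
  if h : x ∈ (boxInterval hab).carrier then
    LinearMap.codRestrict (intervalFiber K (boxInterval hab) x) (f ∘ₗ transition F h.2)
      (fun _ => by simp [intervalFiber, h])
  else 0

theorem boxProjectionApp_val (F : ProductPoset S ⥤ ModuleCat.{u} K) {a b : ProductPoset S}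
    (hab : a ≤ b) (f : F.obj b →ₗ[K] K) {x : ProductPoset S}
    (h : x ∈ (boxInterval hab).carrier) (v : F.obj x) :
    (boxProjectionApp F hab f x v).1 = f (transition F h.2 v) := by
  rw [boxProjectionApp, dif_pos h]
  rfl

/-- The map from `F` to a box module which is given by a functional vanishing on the elements born
outside the box. -/
def boxProjection (F : ProductPoset S ⥤ ModuleCat.{u} K) {a b : ProductPoset S} (hab : a ≤ b)
    (f : F.obj b →ₗ[K] K)
    (hf : ∀ (z : ProductPoset S) (h : z ≤ b), ¬a ≤ z → ∀ w, f (transition F h w) = 0) :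
    F ⟶ intervalModule K (boxInterval hab) where
  app x := ModuleCat.ofHom (boxProjectionApp F hab f x)
  naturality x y g := by
    refine ModuleCat.hom_ext (LinearMap.ext fun v => ?_)
    by_cases hy : y ∈ (boxInterval hab).carrier
    · have hxy : x ≤ y := leOfHom g
      refine Subtype.ext ?_
      change (boxProjectionApp F hab f y (transition F hxy v)).1 =
        (intervalMap K (boxInterval hab) x y (boxProjectionApp F hab f x v)).1
      rw [boxProjectionApp_val F hab f hy, transition_transition]
      by_cases hx : x ∈ (boxInterval hab).carrier
      · rw [intervalMap_val hx hy, boxProjectionApp_val F hab f hx]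
      · rw [hf _ _ (fun h => hx ⟨h, hxy.trans hy.2⟩), intervalFiber_eq_zero hx (boxProjectionApp F hab f x v),
          map_zero]
        rfl
    · exact (intervalFiber_eq_zero hy _).trans (intervalFiber_eq_zero hy _).symm

theorem boxInclusion_comp_boxProjection (F : ProductPoset S ⥤ ModuleCat.{u} K)
    {a b : ProductPoset S} (hab : a ≤ b) (u : F.obj a) (f : F.obj b →ₗ[K] K)
    (huf : f (transition F hab u) = 1)
    (hu : ∀ (z : ProductPoset S) (h : a ≤ z), ¬z ≤ b → transition F h u = 0)
    (hf : ∀ (z : ProductPoset S) (h : z ≤ b), ¬a ≤ z → ∀ w, f (transition F h w) = 0) :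
    boxInclusion F hab u hu ≫ boxProjection F hab f hf = 𝟙 _ := by
  refine NatTrans.ext (funext fun x => ModuleCat.hom_ext (LinearMap.ext fun
    (c : intervalFiber K (boxInterval hab) x) => ?_))
  by_cases hx : x ∈ (boxInterval hab).carrier
  · refine Subtype.ext ?_
    change (boxProjectionApp F hab f x (boxInclusionApp F hab u x c)).1 = c.1
    rw [boxProjectionApp_val F hab f hx, boxInclusionApp_apply F hab u hx.1, map_smul, map_smul,
      transition_transition, huf, smul_eq_mul, mul_one]
  · exact (intervalFiber_eq_zero hx _).trans (intervalFiber_eq_zero hx _).symm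

/-! ### Passage to retracts and induction on the total dimension -/

theorem app_comp_apply {P : Type v} [PartialOrder P] {F G : P ⥤ ModuleCat.{u} K} {s : F ⟶ G}
    {r : G ⟶ F} (hsr : s ≫ r = 𝟙 F) {x : P} (v : F.obj x) :
    (r.app x).hom ((s.app x).hom v) = v :=
  congrArg (fun g : F ⟶ F => (g.app x).hom v) hsr

/-- Include `v` into `G`, lift there, and retract the lift; natural maps preserve dying. -/
theorem HasLifting.of_retract {F G : ProductPoset S ⥤ ModuleCat.{u} K} (hG : HasLifting G)
    {s : F ⟶ G} {r : G ⟶ F} (hsr : s ≫ r = 𝟙 F) : HasLifting F := by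
  intro σ j hj hσ x' x hi h hxj hxi v hv
  obtain ⟨u, huv, hu⟩ := hG σ j hj hσ x' x hi h hxj hxi ((s.app x).hom v) fun z hz hzi => by
    rw [← transition_naturality, hv z hz hzi, map_zero]
  refine ⟨(r.app x').hom u, ?_, fun z hz hzi => ?_⟩
  · rw [← transition_naturality, huv, app_comp_apply hsr]
  · rw [← transition_naturality, hu z hz hzi, map_zero]

theorem imageBelow_map_le {F G : ProductPoset S ⥤ ModuleCat.{u} K} (s : F ⟶ G)
    {σ : Finset (Fin N)} {lo x : ProductPoset S} {v : F.obj x} (hv : v ∈ imageBelow F σ lo x) :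
    (s.app x).hom v ∈ imageBelow G σ lo x := by
  have : imageBelow F σ lo x ≤ (imageBelow G σ lo x).comap (s.app x).hom :=
    imageBelow_le F fun z h hz w => by
      rw [Submodule.mem_comap, transition_naturality]
      exact transition_mem_imageBelow G h hz _
  exact this hv

theorem HasDescent.of_retract {F G : ProductPoset S ⥤ ModuleCat.{u} K} (hG : HasDescent G)
    {s : F ⟶ G} {r : G ⟶ F} (hsr : s ≫ r = 𝟙 F) : HasDescent F := by
  intro σ j hj hσ x x' lo h hxj hxi v hv
  have h1 := hG σ j hj hσ x x' lo h hxj hxi ((s.app x).hom v) (by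
    rw [← transition_naturality]
    exact imageBelow_map_le s hv)
  have h2 := imageBelow_map_le r h1
  rwa [app_comp_apply hsr] at h2

theorem isIntervalDecomposable_of_hasLifting_of_hasDescent [∀ j, Finite (S j)]
    (F : ProductPoset S ⥤ ModuleCat.{u} K) (hF : IsPFD F) (hL : HasLifting F)
    (hD : HasDescent F) : IsIntervalDecomposable F := by
  have := Fintype.ofFinite (ProductPoset S)
  induction hn : ∑ x, Module.finrank K (F.obj x) using Nat.strong_induction_on generalizing F with
  | _ n ih =>
    by_cases h0 : ∀ (x : ProductPoset S) (v : F.obj x), v = 0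
    · exact isIntervalDecomposable_of_forall_eq_zero h0
    push Not at h0
    obtain ⟨x₀, v₀, hv₀⟩ := h0
    obtain ⟨a, b, hab, u, f, huf, hu, hf⟩ := hasBoxGenerator hL hD v₀ hv₀
    let i := boxInclusion F hab u hu
    let p := boxProjection F hab f hf
    have hip : i ≫ p = 𝟙 _ := boxInclusion_comp_boxProjection F hab u f huf hu hf
    let s := kernel.ι p
    -- The idempotent `𝟙 F - p ≫ i` projects onto the kernel of `p`, making it a complement of the
    -- box summand.
    let r : F ⟶ kernel p := kernel.lift p (𝟙 F - p ≫ i) (by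
      rw [Preadditive.sub_comp, Category.assoc, hip, Category.comp_id, Category.id_comp, sub_self])
    have hsp : s ≫ p = 0 := kernel.condition p
    have hrs : r ≫ s = 𝟙 F - p ≫ i := kernel.lift_ι _ _ _
    have hsr : s ≫ r = 𝟙 (kernel p) := by
      rw [← cancel_mono s, Category.assoc, hrs, Preadditive.comp_sub, reassoc_of% hsp, zero_comp,
        sub_zero, Category.comp_id, Category.id_comp]
    have hir : i ≫ r = 0 := by
      rw [← cancel_mono s, Category.assoc, hrs, Preadditive.comp_sub, reassoc_of% hip,
        Category.comp_id, sub_self, zero_comp]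
    have hinj : ∀ x, Function.Injective (s.app x).hom := fun x =>
      Function.LeftInverse.injective (g := (r.app x).hom) fun v => app_comp_apply hsr v
    have hfin : ∀ x, FiniteDimensional K (F.obj x) := hF
    have hpfd : IsPFD (kernel p) := fun x => Module.Finite.of_injective _ (hinj x)
    refine (ih _ ?_ (kernel p) hpfd (hL.of_retract hsr) (hD.of_retract hsr) rfl).of_splitting
      (boxInterval hab) s r i p hsr hip hsp hir (by rw [hrs, sub_add_cancel])
    rw [← hn]
    refine Finset.sum_lt_sum (fun x _ => LinearMap.finrank_le_finrank_of_injective (hinj x))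
      ⟨b, Finset.mem_univ _, ?_⟩
    rw [← LinearMap.finrank_range_of_inj (hinj b)]
    -- The dimension drops at `b`: the image of `u` there is sent to `1` by `f`, hence does not lie
    -- in the kernel of `p`.
    refine Submodule.finrank_lt fun htop => ?_
    obtain ⟨w, hw⟩ := LinearMap.range_eq_top.1 htop (transition F hab u)
    have hb : b ∈ (boxInterval hab).carrier := ⟨hab, le_rfl⟩
    have h1 := boxProjectionApp_val F hab f hb (transition F hab u)
    have h2 : boxProjectionApp F hab f b ((s.app b).hom w) = 0 :=
      congrArg (fun g : kernel p ⟶ _ => (g.app b).hom w) hsp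
    rw [transition_transition, huf, ← hw, h2] at h1
    exact zero_ne_one h1

end Splitting

end Persistence

end

theorem mainTheorem7 {K : Type u} [Field K] {N : ℕ} {S : Fin N → Type v}
    [∀ j, LinearOrder (S j)] [∀ j, Finite (S j)]
    (F : Persistence.ProductPoset S ⥤ ModuleCat.{u} K) (hF : Persistence.IsPFD F)
    (hexact : ∀ k : ℕ, 2 ≤ k → k ≤ N → Persistence.IsMiddleExact k F) :
    Persistence.IsIntervalDecomposable F :=
  Persistence.isIntervalDecomposable_of_hasLifting_of_hasDescent F hF
    (Persistence.hasLifting_of_isMiddleExact F hexact)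
    (Persistence.hasDescent_of_isMiddleExact F hexact)
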